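/- All topological spaces are Tychonoff (completely regular and $T_0$, hence Hausdorff). An ordinal is called even (odd) if it has the form $\lambda+2n$ (respectively $\lambda+2n+1$) with $n\in\omega$ and $\lambda$ equal to $0$ or a limit ordinal. For a topological space $Y$, the classes $\mathcal F_\alpha(Y)$, $1\le\alpha<\omega_1$, are defined by transfinite recursion: $\mathcal F_1(Y)$ is the family of closed subsets of $Y$; for even $\alpha\ge 2$, $\mathcal F_\alpha(Y)$ consists of all countable unions of elements of $\bigcup_{1\le\beta<\alpha}\mathcal F_\beta(Y)$; for odd $\alpha\ge 3$, $\mathcal F_\alpha(Y)$ consists of all countable intersections of elements of $\bigcup_{1\le\beta<\alpha}\mathcal F_\beta(Y)$. A compactification of $X$ is a compact Hausdorff space containing a homeomorphic copy of $X$ as a dense subspace. A space $X$ is an $F_{\sigma\delta}$ space if it is a countable intersection of countable unions of closed sets in some compactification of $X$. A space $X$ is an absolute $\mathcal F_\alpha$ space if $X\in\mathcal F_\alpha(Y)$ for every Tychonoff space $Y$ in which $X$ is densely embedded. **Theorem.** For every even ordinal $\alpha$ with $4\le\alpha<\omega_1$ there exists a Tychonoff space $T_\alpha$ such that 1. $T_\alpha$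 is an $F_{\sigma\delta}$ space; 2. $T_\alpha$ is not an absolute $\mathcal F_\alpha$ space; 3. $T_\alpha$ is an absolute $\mathcal F_{\alpha+1}$ space. -/

import Mathlib

open Set Topology

universe u v

/-- An ordinal is even if it is of the form `l + 2n`, where `l` is zero or a limit ordinal and
`n` is a natural number. (`Order.IsSuccPrelimit l` says that `l` is zero or a limit.) -/
def IsEvenOrdinal (a : Ordinal.{0}) : Prop :=
  ∃ (l : Ordinal.{0}) (n : ℕ), Order.IsSuccPrelimit l ∧ a = l + ((2 * n : ℕ) : Ordinal.{0})

/-- An ordinal is odd if it is of the form `l + (2n + 1)`, where `l` is zero or a limit ordinal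
and `n` is a natural number. -/
def IsOddOrdinal (a : Ordinal.{0}) : Prop :=
  ∃ (l : Ordinal.{0}) (n : ℕ), Order.IsSuccPrelimit l ∧ a = l + ((2 * n + 1 : ℕ) : Ordinal.{0})

/-- The `F`-Borel classes of a topological space: `IsFClass a s` says that `s` belongs to
`F_a(X)`. Here `F_1(X)` consists of the closed sets; for even `a ≥ 2`, `F_a(X)` consists of the
countable unions, and for odd `a ≥ 3` of the countable intersections, of sets taken from
`⋃_{1 ≤ b < a} F_b(X)`. No set has class `0`.
(Sequences cover finite families by repetition; the empty union and the empty intersection are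
closed sets, which belong to every class `F_a(X)`, `a ≥ 1`, anyway.) -/
inductive IsFClass {X : Type u} [TopologicalSpace X] : Ordinal.{0} → Set X → Prop
  | closed (s : Set X) (hs : IsClosed s) : IsFClass 1 s
  | union (a : Ordinal.{0}) (ha : 2 ≤ a) (he : IsEvenOrdinal a)
      (b : ℕ → Ordinal.{0}) (hb : ∀ n, b n < a)
      (s : ℕ → Set X) (hs : ∀ n, IsFClass (b n) (s n)) : IsFClass a (⋃ n, s n)
  | inter (a : Ordinal.{0}) (ha : 3 ≤ a) (ho : IsOddOrdinal a)
      (b : ℕ → Ordinal.{0}) (hb : ∀ n, b n < a)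
      (s : ℕ → Set X) (hs : ∀ n, IsFClass (b n) (s n)) : IsFClass a (⋂ n, s n)

/-- The class `F_{σδ}` of countable intersections of countable unions of closed sets. -/
def IsFSigmaDelta {X : Type u} [TopologicalSpace X] (s : Set X) : Prop :=
  ∃ C : ℕ → ℕ → Set X, (∀ n m, IsClosed (C n m)) ∧ s = ⋂ n, ⋃ m, C n m

/-- `X` is an `F_{σδ}` space: there is a compactification of `X` (a compact
Hausdorff space `K` with a homeomorphic embedding of `X` onto a dense subspace of `K`) in which
`X` is an `F_{σδ}` set. -/
def IsFSigmaDeltaSpace (X : Type u) [TopologicalSpace X] : Prop :=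
  ∃ (K : Type u) (_ : TopologicalSpace K) (_ : CompactSpace K) (_ : T2Space K) (e : X → K),
    IsEmbedding e ∧ DenseRange e ∧ IsFSigmaDelta (range e)

/-- `X` is an absolute `F_a` space: `X` is of class `F_a` in every Tychonoff space `Y` in which
it is densely embedded. -/
def IsAbsoluteFSpace (a : Ordinal.{0}) (X : Type u) [TopologicalSpace X] : Prop :=
  ∀ (Y : Type (max u v)) [TopologicalSpace Y] [T35Space Y] (e : X → Y),
    IsEmbedding e → DenseRange e → IsFClass a (range e)

/-!
The space `T` has one nonisolated point `∞`. Its isolated points are *nodes*: a node `x` has a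
label `x.label : ℕ → ℕ` and remembers a countable set of pairs of earlier nodes. The complements
of the neighbourhoods of `∞` are generated by finite sets and by a family of countable sets of
nodes, the ranges of certain *threads*. Two different threads have only finitely many common nodes
(`IsThread.eq_of_infinite`), so adding one limit point for each thread gives a Mrówka space, and
its one-point compactification is a compact space `K` in which `T` is dense. A thread is admitted
if the tree of finite sequences that are initial segments of the labels of infinitely many of its
nodes is well-founded with a rank bounded in terms of `α`; this is the predicate `Thin`, whose
clauses follow the recursion defining the classes `F_α`.

*Upper bounds.* In any Hausdorff extension `Y` of `T`, attach to a finite sequence `s` the closure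
of the set of nodes with label extending `s`, with `∞` added. A point of `Y` defines the tree of
those `s` whose closed set contains it. For points of `T` this tree has an infinite branch. A
point outside `T` is separated from `∞`, so near it only the nodes of finitely many threads matter
and its tree is thin. Hence `T` is the set of points with a non-thin tree
(`IsNodeSpace.range_eq`), and the recursion defining thinness shows that this set is of class
`F_{α+1}` (`isFClass_setOf_not_thin`). In the Stone–Čech compactification the closed sets of
incomparable sequences do not meet outside `T`, and `T` is the intersection over `n` of the union
of the closed sets of the sequences of length `n`.

*Lower bound.* Let `F ⊆ K` be of class `F_α` and contain all nodes. Conditions are pairs of a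
countable record `G` and a finite sequence `s`; they are closed under unions of increasing
sequences in the first coordinate, and the second coordinate carries Baire category on `ℕ → ℕ`. A
set of nodes is `Ample` below `(G, s)` if over each extension of `G` its labels are nonmeagre
everywhere in the cylinder of `s`. If a countable union is ample, one of its members is ample
below a stronger condition (`Ample.exists_of_iUnion`). By induction on the class, an ample `F` of
class `F_α` yields countably many ample sets, arranged along a thin tree of sequences, such that
any thread meeting each of them infinitely often converges to a point of `F`
(`IsFClass.exists_scheme`). Such a thread exists (`exists_thread`), because a node does not
remember its own place in a thread and may therefore be chosen freely from an ample set. So `F`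
contains a point of `K` outside `T`.
-/

/-! ### Even ordinals -/

theorem isEvenOrdinal_zero : IsEvenOrdinal 0 :=
  ⟨0, 0, Order.isSuccPrelimit_bot, by simp⟩

/-- The decomposition of an ordinal into a zero-or-limit part and a finite part is unique. -/
theorem natCast_eq_of_prelimit_add_eq {l l' : Ordinal.{0}} {m n : ℕ}
    (hl : Order.IsSuccPrelimit l) (hl' : Order.IsSuccPrelimit l')
    (h : l + (m : Ordinal.{0}) = l' + (n : Ordinal.{0})) : m = n := by
  have key : ∀ {k k' : Ordinal.{0}} {p : ℕ} (q : ℕ), Order.IsSuccPrelimit k' → k < k' →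
      k + (p : Ordinal.{0}) < k' + (q : Ordinal.{0}) := by
    intro k k' p q hk' hlt
    have : k + (p : Ordinal.{0}) < k' := by
      induction p with
      | zero => simpa using hlt
      | succ p ih =>
        rw [Nat.cast_succ, ← add_assoc]
        exact hk'.succ_lt ih
    exact this.trans_le le_self_add
  rcases lt_trichotomy l l' with hlt | rfl | hlt
  · exact absurd h (key n hl' hlt).ne
  · exact_mod_cast (add_right_inj l).1 h
  · exact absurd h (key m hl hlt).ne'

theorem IsEvenOrdinal.add_one {a : Ordinal.{0}} (h : IsEvenOrdinal a) : IsOddOrdinal (a + 1) := by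
  obtain ⟨l, n, hl, rfl⟩ := h
  exact ⟨l, n, hl, by push_cast; rw [add_assoc]⟩

theorem IsOddOrdinal.exists_eq_add_one {a : Ordinal.{0}} (h : IsOddOrdinal a) :
    ∃ b, IsEvenOrdinal b ∧ a = b + 1 := by
  obtain ⟨l, n, hl, rfl⟩ := h
  exact ⟨_, ⟨l, n, hl, rfl⟩, by push_cast; rw [add_assoc]⟩

theorem IsEvenOrdinal.not_isOddOrdinal {a : Ordinal.{0}} (h : IsEvenOrdinal a) :
    ¬ IsOddOrdinal a := by
  obtain ⟨l, n, hl, rfl⟩ := h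
  rintro ⟨l', n', hl', h⟩
  have := natCast_eq_of_prelimit_add_eq hl hl' h
  omega

theorem IsEvenOrdinal.add_one_lt {a b : Ordinal.{0}} (ha : IsEvenOrdinal a)
    (hb : IsEvenOrdinal b) (h : b < a) : b + 1 < a := by
  refine lt_of_le_of_ne (Order.add_one_le_of_lt h) ?_
  rintro rfl
  exact ha.not_isOddOrdinal hb.add_one

theorem IsEvenOrdinal.two_le {a : Ordinal.{0}} (ha : IsEvenOrdinal a) (h : a ≠ 0) : 2 ≤ a := by
  have := ha.add_one_lt isEvenOrdinal_zero (pos_iff_ne_zero.2 h)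
  have := Order.add_one_le_of_lt this
  rwa [zero_add, one_add_one_eq_two] at this

/-! ### Thin trees of finite sequences -/

/-- A set of finite sequences of natural numbers closed under initial segments. -/
def IsTree (T : Set (List ℕ)) : Prop :=
  ∀ ⦃s t : List ℕ⦄, s <+: t → t ∈ T → s ∈ T

/-- `Thin T a s` bounds the well-founded rank of `T` above the node `s`. If `a = l + 2n` with
`l` zero or a limit, it says that this rank is less than `ω * (l + n)`: at a thin node, after
finitely many steps every further node is thin of some fixed smaller even index. -/
inductive Thin (T : Set (List ℕ)) : Ordinal.{0} → List ℕ → Prop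
  | out (a : Ordinal.{0}) (s : List ℕ) (h : s ∉ T) : Thin T a s
  | step (a b : Ordinal.{0}) (N : ℕ) (s : List ℕ) (hb : IsEvenOrdinal b) (hba : b < a)
      (h : ∀ w : List ℕ, N ≤ w.length → Thin T b (s ++ w)) : Thin T a s

theorem Thin.mono_index {T : Set (List ℕ)} {a b : Ordinal.{0}} {s : List ℕ} (h : Thin T a s)
    (hab : a ≤ b) : Thin T b s := by
  cases h with
  | out _ _ h => exact .out _ _ h
  | step _ c N _ hc hca h => exact .step _ c N _ hc (hca.trans_le hab) h

theorem Thin.append {T : Set (List ℕ)} (hT : IsTree T) {a : Ordinal.{0}} {s : List ℕ}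
    (h : Thin T a s) (w : List ℕ) : Thin T a (s ++ w) := by
  cases h with
  | out _ _ h => exact .out _ _ fun h' => h (hT (List.prefix_append s w) h')
  | step _ c N _ hc hca h =>
    refine .step _ c N _ hc hca fun w' hw' => ?_
    rw [List.append_assoc]
    exact h _ (by simp; omega)

theorem Thin.anti {T T' : Set (List ℕ)} {a : Ordinal.{0}} {s : List ℕ} (h : Thin T a s)
    (hT : T' ⊆ T) : Thin T' a s := by
  induction h with
  | out a s h => exact .out _ _ fun h' => h (hT h')
  | step a b N s hb hba _ ih => exact .step a b N s hb hba ih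

/-- Thinness at `s` only depends on the part of the tree above `s`. -/
theorem Thin.of_eq_above {T T' : Set (List ℕ)} {a : Ordinal.{0}} {s : List ℕ} (h : Thin T a s)
    (hT : ∀ w, s ++ w ∈ T' → s ++ w ∈ T) : Thin T' a s := by
  induction h with
  | out a s h => exact .out _ _ fun h' => h (by simpa using hT [] (by simpa using h'))
  | step a b N s hb hba _ ih =>
    refine .step a b N s hb hba fun w hw => ih w hw fun w' => ?_
    rw [List.append_assoc]
    exact hT _

theorem Thin.union {T T' : Set (List ℕ)} (hT : IsTree T) (hT' : IsTree T') {a : Ordinal.{0}}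
    {s : List ℕ} (h : Thin T a s) (h' : Thin T' a s) : Thin (T ∪ T') a s := by
  induction a using WellFoundedLT.induction generalizing s with
  | ind a ih =>
  have out_step : ∀ {U U' : Set (List ℕ)}, IsTree U → s ∉ U → ∀ {b : Ordinal.{0}} {N : ℕ}
      {w : List ℕ}, (∀ w : List ℕ, N ≤ w.length → Thin U' b (s ++ w)) → N ≤ w.length →
      Thin U b (s ++ w) := fun hU hs b N w _ _ =>
    .out _ _ fun h => hs (hU (List.prefix_append _ _) h)
  rcases h with ⟨_, _, h⟩ | ⟨_, b, N, _, hb, hba, h⟩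
  · rcases h' with ⟨_, _, h'⟩ | ⟨_, b', N', _, hb', hba', h'⟩
    · exact .out _ _ (by simp [h, h'])
    · exact .step _ b' N' _ hb' hba' fun w hw =>
        ih _ hba' (out_step hT h h' hw) (h' w hw)
  · rcases h' with ⟨_, _, h'⟩ | ⟨_, b', N', _, hb', hba', h'⟩
    · exact .step _ b N _ hb hba fun w hw =>
        ih _ hba (h w hw) (out_step hT' h' h hw)
    · rcases le_total b b' with hle | hle
      · exact .step _ b' (max N N') _ hb' hba' fun w hw => ih _ hba'
          ((h w ((le_max_left _ _).trans hw)).mono_index hle) (h' w ((le_max_right _ _).trans hw))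
      · exact .step _ b (max N N') _ hb hba fun w hw => ih _ hba
          (h w ((le_max_left _ _).trans hw)) ((h' w ((le_max_right _ _).trans hw)).mono_index hle)

/-! ### Initial segments of sequences -/

/-- The set of infinite sequences with initial segment `s`. -/
def cyl (s : List ℕ) : Set (ℕ → ℕ) :=
  {y | ∀ i < s.length, s[i]? = some (y i)}

theorem mem_cyl_ofFn (y : ℕ → ℕ) (n : ℕ) : y ∈ cyl (List.ofFn fun i : Fin n => y i) := by
  intro i hi
  simp at hi
  simp [hi]

theorem cyl_nil : cyl [] = univ := by
  ext; simp [cyl]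

theorem cyl_anti {s t : List ℕ} (h : s <+: t) : cyl t ⊆ cyl s := by
  intro y hy i hi
  rw [← hy i (hi.trans_le h.length_le)]
  obtain ⟨w, rfl⟩ := h
  rw [List.getElem?_append_left hi]

theorem cyl_nonempty (s : List ℕ) : (cyl s).Nonempty :=
  ⟨fun i => s.getD i 0, fun i hi => by simp [hi]⟩

theorem prefix_of_mem_cyl {s t : List ℕ} {y : ℕ → ℕ} (hs : y ∈ cyl s) (ht : y ∈ cyl t)
    (h : s.length ≤ t.length) : s <+: t := by
  rw [List.prefix_iff_eq_take]
  apply List.ext_getElem?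
  intro i
  rw [List.getElem?_take]
  split_ifs with hi
  · rw [hs i hi, ht i (hi.trans_le h)]
  · rw [List.getElem?_eq_none (not_lt.1 hi)]

theorem cyl_eq_cylinder {s : List ℕ} {y : ℕ → ℕ} (h : y ∈ cyl s) :
    cyl s = PiNat.cylinder y s.length := by
  ext z
  rw [PiNat.mem_cylinder_iff]
  refine forall₂_congr fun i hi => ?_
  rw [h i hi, Option.some_inj, eq_comm]

theorem isOpen_cyl (s : List ℕ) : IsOpen (cyl s) := by
  obtain ⟨y, hy⟩ := cyl_nonempty s
  rw [cyl_eq_cylinder hy]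
  exact PiNat.isOpen_cylinder _ _ _

/-- Inside a cylinder, every nonempty open set contains a smaller cylinder. -/
theorem exists_cyl_subset {s : List ℕ} {y : ℕ → ℕ} {U : Set (ℕ → ℕ)} (hy : y ∈ cyl s)
    (hyU : y ∈ U) (hU : IsOpen U) : ∃ t, s <+: t ∧ y ∈ cyl t ∧ cyl t ⊆ U := by
  obtain ⟨_, ⟨z, n, rfl⟩, hyz, hzU⟩ :=
    (PiNat.isTopologicalBasis_cylinders fun _ : ℕ => ℕ).exists_subset_of_mem_open hyU hU
  have hm := mem_cyl_ofFn y (max n s.length)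
  refine ⟨_, prefix_of_mem_cyl hy hm (by simp), hm, ?_⟩
  refine Subset.trans ?_ hzU
  rw [cyl_eq_cylinder hm, ← PiNat.mem_cylinder_iff_eq.1 hyz]
  exact PiNat.cylinder_anti _ (by simp)

theorem not_isMeagre_cyl (s : List ℕ) : ¬ IsMeagre (cyl s) :=
  not_isMeagre_of_isOpen (isOpen_cyl s) (cyl_nonempty s)

/-- A set which is meagre in densely many cylinders below `s` is meagre in the cylinder of `s`. -/
theorem isMeagre_inter_cyl {P : Set (ℕ → ℕ)} {s : List ℕ}
    (h : ∀ t, s <+: t → ∃ t', t <+: t' ∧ IsMeagre (P ∩ cyl t')) : IsMeagre (P ∩ cyl s) := by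
  set W : Set (ℕ → ℕ) := ⋃ t ∈ {t | IsMeagre (P ∩ cyl t)}, cyl t with hW
  have hWo : IsOpen W := isOpen_biUnion fun t _ => isOpen_cyl t
  have h1 : IsMeagre (⋃ t : {t : List ℕ | IsMeagre (P ∩ cyl t)}, P ∩ cyl (t : List ℕ)) :=
    isMeagre_iUnion fun t => t.2
  have h2 : IsNowhereDense (cyl s \ W) := by
    rw [IsNowhereDense, eq_empty_iff_forall_notMem]
    intro y hy
    have hyc : y ∈ closure (cyl s \ W) := interior_subset hy
    obtain ⟨z, hz, hzs, hzW⟩ := mem_closure_iff.1 hyc _ isOpen_interior hy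
    obtain ⟨t, hst, hzt, htU⟩ := exists_cyl_subset hzs hz isOpen_interior
    obtain ⟨t', htt', hm⟩ := h t hst
    obtain ⟨x, hx⟩ := cyl_nonempty t'
    have hxW : cyl t' ⊆ W := subset_biUnion_of_mem (u := cyl) (show t' ∈ _ from hm)
    have hxc : x ∈ closure (cyl s \ W) := interior_subset (htU (cyl_anti htt' hx))
    obtain ⟨x', hx', hx''⟩ := mem_closure_iff.1 hxc _ (isOpen_cyl t') hx
    exact hx''.2 (hxW hx')
  refine (h1.union h2.isMeagre).mono ?_
  rintro y ⟨hyP, hys⟩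
  by_cases hyW : y ∈ W
  · left
    obtain ⟨t, ht, hyt⟩ := mem_iUnion₂.1 hyW
    exact mem_iUnion.2 ⟨⟨t, ht⟩, hyP, hyt⟩
  · exact Or.inr ⟨hys, hyW⟩

/-- A tree with an infinite branch is not thin along that branch. -/
theorem not_thin_of_branch {T : Set (List ℕ)} {y : ℕ → ℕ} (hy : ∀ s, y ∈ cyl s → s ∈ T)
    {a : Ordinal.{0}} {s : List ℕ} (hs : y ∈ cyl s) : ¬ Thin T a s := by
  intro h
  induction h with
  | out a s h => exact h (hy s hs)
  | step a b N s _ _ _ ih =>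
    obtain ⟨w, hw⟩ := prefix_of_mem_cyl hs (mem_cyl_ofFn y (s.length + N)) (by simp)
    refine ih w ?_ ?_
    · have := congrArg List.length hw
      simp at this
      omega
    · rw [hw]
      exact mem_cyl_ofFn y _

/-! ### Nodes, records and threads -/

/-- The isolated points of the spaces constructed below. A node `mk y key val` carries an infinite
sequence `y` of natural numbers and a countable list of pairs of earlier nodes; the node `nil` is
a starting point. -/
inductive Node : Type
  | nil
  | mk (y : ℕ → ℕ) (key val : ℕ → Node)

namespace Node

/-- The sequence of natural numbers carried by a node (the zero sequence for `nil`). -/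
def label : Node → ℕ → ℕ
  | nil => 0
  | mk y _ _ => y

/-- The countable set of pairs of earlier nodes that a node remembers. -/
def record : Node → Set (Node × Node)
  | nil => ∅
  | mk _ key val => range fun n => (key n, val n)

/-- A node does not remember itself, since the pairs it remembers consist of proper subterms. -/
theorem notMem_record_self (x v : Node) : (x, v) ∉ x.record := by
  have key : ∀ x y k w, x = mk y k w → ∀ n, k n ≠ x := by
    intro x
    induction x with
    | nil => intro y k w h; cases h
    | mk y k w ih _ =>
      rintro y' k' w' ⟨⟩ n hn
      exact ih n _ _ _ hn n rfl
  cases x with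
  | nil => exact notMem_empty _
  | mk y k w =>
    rintro ⟨n, hn⟩
    exact key _ y k w rfl n (congrArg Prod.fst hn)

end Node

/-- The sets of pairs that a node may remember: graphs of nonempty countable partial functions.
They are ordered by inclusion. -/
def Record : Type :=
  {G : Set (Node × Node) // G.Countable ∧ G.Nonempty ∧ ∀ a b c, (a, b) ∈ G → (a, c) ∈ G → b = c}

instance : PartialOrder Record := inferInstanceAs (PartialOrder (Subtype _))

instance : Nonempty Record :=
  ⟨⟨{(Node.nil, Node.nil)}, countable_singleton _, singleton_nonempty _, by simp +contextual⟩⟩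

theorem Record.exists_node (G : Record) (y : ℕ → ℕ) :
    ∃ x : Node, x.record = G.1 ∧ x.label = y := by
  obtain ⟨f, hf⟩ := G.2.1.exists_eq_range G.2.2.1
  exact ⟨.mk y (fun n => (f n).1) (fun n => (f n).2), by simp [Node.record, hf], rfl⟩

theorem Record.exists_ge_of_monotone {G : ℕ → Record} (hG : Monotone G) :
    ∃ G' : Record, ∀ n, G n ≤ G' := by
  refine ⟨⟨⋃ n, (G n).1, countable_iUnion fun n => (G n).2.1,
    (G 0).2.2.1.mono (subset_iUnion (fun n => (G n).1) 0), ?_⟩,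
    fun n => subset_iUnion (fun n => (G n).1) n⟩
  intro a b c hb hc
  obtain ⟨m, hm⟩ := mem_iUnion.1 hb
  obtain ⟨n, hn⟩ := mem_iUnion.1 hc
  exact (G (max m n)).2.2.2 a b c (hG (le_max_left m n) hm) (hG (le_max_right m n) hn)

/-- Countably many upward closed properties, each of which can be achieved by extending a record,
can be achieved simultaneously. -/
theorem Record.exists_ge_forall {ι : Type*} [Countable ι] (R : ι → Record → Prop)
    (hR : ∀ i G G', G ≤ G' → R i G → R i G') (G : Record)
    (h : ∀ i, ∀ G' ≥ G, ∃ G'' ≥ G', R i G'') : ∃ G' ≥ G, ∀ i, R i G' := by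
  cases isEmpty_or_nonempty ι with
  | inl _ => exact ⟨G, le_rfl, fun i => isEmptyElim i⟩
  | inr _ =>
    obtain ⟨e, he⟩ := exists_surjective_nat ι
    have h' : ∀ (n : ℕ) (G' : {G' // G ≤ G'}), ∃ G'' : {G' // G ≤ G'},
        G'.1 ≤ G''.1 ∧ R (e n) G''.1 := fun n G' => by
      obtain ⟨G'', h1, h2⟩ := h (e n) G'.1 G'.2
      exact ⟨⟨G'', G'.2.trans h1⟩, h1, h2⟩
    choose f hf hfR using h'
    let H : ℕ → {G' // G ≤ G'} := fun n => Nat.rec ⟨G, le_rfl⟩ f n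
    have hH : Monotone fun n => (H n).1 := monotone_nat_of_le_succ fun n => hf n (H n)
    obtain ⟨G', hG'⟩ := Record.exists_ge_of_monotone hH
    refine ⟨G', (H 0).2.trans (hG' 0), fun i => ?_⟩
    obtain ⟨n, rfl⟩ := he i
    exact hR _ _ _ (hG' (n + 1)) (hfR n (H n))

/-- The predecessor of the `i`-th term of a sequence of nodes, with value `nil` for `i = 0`. -/
def predNode (u : ℕ → Node) : ℕ → Node
  | 0 => .nil
  | i + 1 => u i

/-- A thread is a sequence of nodes in which each node remembers, for every earlier term, the
predecessor of that term. A term does not remember its own predecessor; this is what makes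
threads abundant, while any later term suffices to recover the thread up to a given term. The
terms differ from `nil`, so that the predecessor `nil` marks the first term. -/
structure IsThread (u : ℕ → Node) : Prop where
  ne_nil : ∀ n, u n ≠ .nil
  functional : ∀ n a b c, (a, b) ∈ (u n).record → (a, c) ∈ (u n).record → b = c
  mem_record : ∀ i n, i < n → (u i, predNode u i) ∈ (u n).record

theorem IsThread.injective {u : ℕ → Node} (hu : IsThread u) : Function.Injective u := by
  have key : ∀ i n, i < n → u i ≠ u n := by
    intro i n hin h
    have := hu.mem_record i n hin
    rw [h] at this
    exact Node.notMem_record_self _ _ this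
  intro i n h
  rcases lt_trichotomy i n with hlt | heq | hlt
  · exact absurd h (key _ _ hlt)
  · exact heq
  · exact absurd h.symm (key _ _ hlt)

/-- Two threads with a common node have the same initial segments up to any earlier common
node. -/
theorem IsThread.eq_of_common {u v : ℕ → Node} (hu : IsThread u) (hv : IsThread v) {k l : ℕ}
    (hkl : u k = v l) : ∀ i j, i < k → j < l → u i = v j → i = j ∧ ∀ m ≤ i, u m = v m := by
  have hpred : ∀ i j, i < k → j < l → u i = v j → predNode u i = predNode v j := by
    intro i j hi hj hij
    have h1 := hu.mem_record i k hi
    have h2 := hv.mem_record j l hj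
    rw [← hkl, ← hij] at h2
    exact hu.functional k _ _ _ h1 h2
  intro i
  induction i with
  | zero =>
    intro j hi hj hij
    have h := hpred 0 j hi hj hij
    cases j with
    | zero => exact ⟨rfl, fun m hm => by rw [Nat.le_zero.1 hm, hij]⟩
    | succ j => exact absurd h.symm (hv.ne_nil j)
  | succ i ih =>
    intro j hi hj hij
    have h := hpred (i + 1) j hi hj hij
    cases j with
    | zero => exact absurd h (hu.ne_nil i)
    | succ j =>
      obtain ⟨rfl, h'⟩ := ih j (by omega) (by omega) h
      refine ⟨rfl, fun m hm => ?_⟩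
      rcases Nat.le_succ_iff.1 hm with hm | rfl
      · exact h' m hm
      · exact hij

/-- Threads with infinitely many common nodes are equal. -/
theorem IsThread.eq_of_infinite {u v : ℕ → Node} (hu : IsThread u) (hv : IsThread v)
    (h : (range u ∩ range v).Infinite) : u = v := by
  have common : ∀ N, ∃ k l, N < k ∧ N < l ∧ u k = v l := by
    intro N
    obtain ⟨x, ⟨⟨k, rfl⟩, l, hl⟩, hx⟩ :=
      (h.sdiff (((finite_Iic N).image u).union ((finite_Iic N).image v))).nonempty
    refine ⟨k, l, ?_, ?_, hl.symm⟩
    · exact not_le.1 fun hk => hx (Or.inl ⟨k, hk, rfl⟩)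
    · exact not_le.1 fun hk => hx (Or.inr ⟨l, hk, hl⟩)
  funext n
  obtain ⟨i, j, hi, -, hij⟩ := common n
  obtain ⟨k, l, hk, hl, hkl⟩ := common (max i j)
  exact (hu.eq_of_common hv hkl i j (by omega) (by omega) hij).2 n hi.le

/-- The tree of those finite sequences which are initial segments of the labels of infinitely many
nodes in `A`. -/
def splitTree (A : Set Node) : Set (List ℕ) :=
  {s | {x ∈ A | x.label ∈ cyl s}.Infinite}

theorem isTree_splitTree (A : Set Node) : IsTree (splitTree A) := fun _ _ hst ht =>
  Infinite.mono (fun _ hx => ⟨hx.1, cyl_anti hst hx.2⟩) ht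

theorem splitTree_union (A B : Set Node) : splitTree (A ∪ B) = splitTree A ∪ splitTree B := by
  ext s
  have : {x ∈ A ∪ B | x.label ∈ cyl s} = {x ∈ A | x.label ∈ cyl s} ∪ {x ∈ B | x.label ∈ cyl s} := by
    ext x; simp [or_and_right]
  exact (iff_of_eq (congrArg Set.Infinite this)).trans infinite_union

theorem splitTree_mono {A B : Set Node} (h : A ⊆ B) : splitTree A ⊆ splitTree B := fun _ hs =>
  Infinite.mono (fun _ hx => ⟨h hx.1, hx.2⟩) hs

theorem splitTree_of_finite {A : Set Node} (h : A.Finite) : splitTree A = ∅ :=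
  eq_empty_of_forall_notMem fun _ hs => hs (h.subset fun _ hx => hx.1)

/-- The sets of nodes that get a limit point in the space constructed from `a`: the ranges of
threads with thin tree. -/
def threadFamily (a : Ordinal.{0}) : Set (Set Node) :=
  {A | (∃ u, IsThread u ∧ A = range u) ∧ Thin (splitTree A) a []}

theorem threadFamily_almostDisjoint {a : Ordinal.{0}} {A B : Set Node} (hA : A ∈ threadFamily a)
    (hB : B ∈ threadFamily a) (h : A ≠ B) : (A ∩ B).Finite := by
  obtain ⟨⟨u, hu, rfl⟩, -⟩ := hA
  obtain ⟨⟨v, hv, rfl⟩, -⟩ := hB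
  by_contra hinf
  exact h (by rw [hu.eq_of_infinite hv hinf])

/-! ### Ample sets of nodes -/

/-- The nodes in `S` whose record is a functional set of pairs extending `G`. -/
def nodesAbove (S : Set Node) (G : Record) : Set Node :=
  {x ∈ S | ∃ H ≥ G, x.record = H.1}

theorem nodesAbove_anti {S : Set Node} {G G' : Record} (h : G ≤ G') :
    nodesAbove S G' ⊆ nodesAbove S G := fun _ ⟨hx, H, hH, hxH⟩ => ⟨hx, H, h.trans hH, hxH⟩

/-- A largeness property of a set `S` of nodes below the condition `(G, s)`: for every extension
of `G`, the labels of the nodes in `S` above it form a set which is nonmeagre in every cylinder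
inside the cylinder of `s`. -/
def Ample (S : Set Node) (G : Record) (s : List ℕ) : Prop :=
  ∀ G' ≥ G, ∀ t, s <+: t → ¬ IsMeagre (Node.label '' nodesAbove S G' ∩ cyl t)

theorem Ample.mono {S S' : Set Node} {G G' : Record} {s t : List ℕ} (h : Ample S G s)
    (hS : S ⊆ S') (hG : G ≤ G') (hs : s <+: t) : Ample S' G' t := by
  intro G'' hG'' t' ht' hm
  refine h G'' (hG.trans hG'') t' (hs.trans ht') (hm.mono ?_)
  exact inter_subset_inter_left _ (image_mono fun x hx => ⟨hS hx.1, hx.2⟩)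

theorem ample_univ (G : Record) (s : List ℕ) : Ample univ G s := by
  intro G' _ t _
  have : Node.label '' nodesAbove univ G' = univ := by
    refine eq_univ_of_forall fun y => ?_
    obtain ⟨x, hx, rfl⟩ := G'.exists_node y
    exact ⟨x, ⟨mem_univ _, G', le_rfl, hx⟩, rfl⟩
  rw [this, univ_inter]
  exact not_isMeagre_cyl t

theorem Ample.exists_mem {S : Set Node} {G : Record} {s : List ℕ} (h : Ample S G s) {G' : Record}
    (hG : G ≤ G') {t : List ℕ} (hs : s <+: t) :
    ∃ x ∈ S, (∃ H ≥ G', x.record = H.1) ∧ x.label ∈ cyl t := by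
  obtain ⟨_, ⟨x, hx, rfl⟩, hxt⟩ := nonempty_of_not_isMeagre (h G' hG t hs)
  exact ⟨x, hx.1, hx.2, hxt⟩

/-- If an ample set is covered by countably many sets, then one of them is ample below a stronger
condition. -/
theorem Ample.exists_of_iUnion {S : ℕ → Set Node} {G : Record} {s : List ℕ}
    (h : Ample (⋃ n, S n) G s) : ∃ n, ∃ G' ≥ G, ∃ t, s <+: t ∧ Ample (S n) G' t := by
  by_contra! hcon
  -- A single extension of `G` makes every piece meagre in densely many cylinders.
  obtain ⟨G', hG', hR⟩ := Record.exists_ge_forall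
    (fun (i : ℕ × {t : List ℕ // s <+: t}) G' =>
      ∃ t', i.2.1 <+: t' ∧ IsMeagre (Node.label '' nodesAbove (S i.1) G' ∩ cyl t'))
    (fun i G₁ G₂ h12 ⟨t', ht', hm⟩ => ⟨t', ht', hm.mono
      (inter_subset_inter_left _ (image_mono (nodesAbove_anti h12)))⟩) G
    (fun i G₁ hG₁ => by
      have := hcon i.1 G₁ hG₁ i.2.1 i.2.2
      simp only [Ample, not_forall, not_not] at this
      obtain ⟨G₂, hG₂, t, ht, hm⟩ := this
      exact ⟨G₂, hG₂, t, ht, hm⟩)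
  refine h G' hG' s (List.prefix_refl s) ?_
  have hm : IsMeagre (⋃ n, Node.label '' nodesAbove (S n) G' ∩ cyl s) :=
    isMeagre_iUnion fun n => isMeagre_inter_cyl fun t ht => hR (n, ⟨t, ht⟩)
  refine hm.mono ?_
  rintro y ⟨⟨x, ⟨hxS, hxG⟩, rfl⟩, hys⟩
  obtain ⟨n, hn⟩ := mem_iUnion.1 hxS
  exact mem_iUnion.2 ⟨n, ⟨x, ⟨hn, hxG⟩, rfl⟩, hys⟩

/-- The record of a node can be extended by any value for the node itself. -/
theorem exists_record_insert {x : Node} {G : Record} (hG : x.record = G.1) (v : Node) :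
    ∃ G' : Record, G ≤ G' ∧ (x, v) ∈ G'.1 := by
  refine ⟨⟨insert (x, v) G.1, G.2.1.insert _, insert_nonempty _ _, ?_⟩, subset_insert _ _,
    mem_insert _ _⟩
  have hx : ∀ w, (x, w) ∉ G.1 := fun w hw => Node.notMem_record_self x w (hG ▸ hw)
  rintro a b c (hab | hab) (hac | hac)
  · rw [Prod.mk.injEq] at hab hac
    rw [hab.2, hac.2]
  · rw [Prod.mk.injEq] at hab
    exact absurd hac (hab.1 ▸ hx c)
  · rw [Prod.mk.injEq] at hac
    exact absurd hab (hac.1 ▸ hx b)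
  · exact G.2.2.2 a b c hab hac

/-- The initial segments of the members of a family of finite sequences. -/
def prefixTree (t : ℕ → List ℕ) : Set (List ℕ) :=
  {s | ∃ i, s <+: t i}

theorem isTree_prefixTree (t : ℕ → List ℕ) : IsTree (prefixTree t) :=
  fun _ _ hst ⟨i, hi⟩ => ⟨i, hst.trans hi⟩

/-- Given countably many ample sets `S i` below conditions `(G, t i)` with a common record, some
thread meets each of them infinitely often and only splits along the sequences `t i`. -/
theorem exists_thread {G : Record} {t : ℕ → List ℕ} {S : ℕ → Set Node}
    (h : ∀ i, Ample (S i) G (t i)) : ∃ u, IsThread u ∧ (∀ i, (range u ∩ S i).Infinite) ∧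
      splitTree (range u) ⊆ prefixTree t := by
  -- The `n`-th node is taken from `S i`, `i = n.unpair.1`, in the cylinder of `t i ++ [n]`; the
  -- last entry `n` keeps the nodes chosen from the same `S i` apart.
  have hstep : ∀ (n : ℕ) (p : {G' // G ≤ G'} × Node), ∃ (x : Node) (G' : {G' // G ≤ G'}),
      x ∈ S n.unpair.1 ∧ (∃ H : Record, p.1.1 ≤ H ∧ x.record = H.1 ∧ H ≤ G'.1) ∧
      (x, p.2) ∈ G'.1.1 ∧ x.label ∈ cyl (t n.unpair.1 ++ [n]) := by
    rintro n ⟨⟨G₁, hG₁⟩, q⟩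
    obtain ⟨x, hxS, ⟨H, hH, hxH⟩, hxt⟩ := (h n.unpair.1).exists_mem hG₁ (List.prefix_append _ [n])
    obtain ⟨G', hHG', hx⟩ := exists_record_insert hxH q
    exact ⟨x, ⟨G', hG₁.trans (le_trans hH hHG')⟩, hxS, ⟨H, hH, hxH, hHG'⟩, hx, hxt⟩
  choose x next hxS hrec hnext hxt using hstep
  let p : ℕ → {G' // G ≤ G'} × Node :=
    fun n => Nat.rec (⟨G, le_rfl⟩, .nil) (fun n q => (next n q, x n q)) n
  let u : ℕ → Node := fun n => x n (p n)
  have hp : ∀ n, (p n).2 = predNode u n := by rintro (_ | n) <;> rfl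
  have hmono : Monotone fun n => (p n).1.1 := monotone_nat_of_le_succ fun n => by
    obtain ⟨H, h1, -, h2⟩ := hrec n (p n)
    exact h1.trans h2
  have hu : IsThread u := by
    refine ⟨fun n hn => ?_, fun n => ?_, fun i n hin => ?_⟩
    · obtain ⟨H, -, h1, -⟩ := hrec n (p n)
      obtain ⟨e, he⟩ := H.2.2.1
      rw [← h1, show x n (p n) = .nil from hn] at he
      exact he
    · obtain ⟨H, -, h1, -⟩ := hrec n (p n)
      rw [show (u n).record = H.1 from h1]
      exact H.2.2.2
    · obtain ⟨H, h0, h1, -⟩ := hrec n (p n)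
      rw [show (u n).record = H.1 from h1, ← hp]
      exact h0 (hmono (Nat.succ_le_of_lt hin) (hnext i (p i)))
  refine ⟨u, hu, fun i => ?_, fun s hs => ?_⟩
  · refine (infinite_range_of_injective (f := fun m => u (Nat.pair i m)) ?_).mono ?_
    · intro m m' hm
      exact (Nat.pair_eq_pair.1 (hu.injective hm)).2
    · rintro _ ⟨m, rfl⟩
      refine ⟨mem_range_self _, ?_⟩
      have := hxS (Nat.pair i m) (p (Nat.pair i m))
      rwa [Nat.unpair_pair] at this
  · by_contra hst
    refine hs ((s.toFinset.finite_toSet.image u).subset ?_)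
    rintro _ ⟨⟨n, rfl⟩, hn⟩
    refine ⟨n, ?_, rfl⟩
    have hn' := hxt n (p n)
    rcases le_or_gt s.length (t n.unpair.1).length with hle | hlt
    · exact absurd ⟨_, prefix_of_mem_cyl hn (cyl_anti (List.prefix_append _ _) hn') hle⟩ hst
    · have := prefix_of_mem_cyl hn' hn (by simp; omega)
      simpa using this.subset (by simp : n ∈ _ ++ [n])

/-! ### The Mrówka space of an almost disjoint family -/

/-- The Mrówka space of a family `𝒜` of subsets of `D`: the points of `D` are isolated, and every
`A ∈ 𝒜` is a point whose neighbourhoods contain all but finitely many elements of the set `A`. -/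
def Mrowka {D : Type u} (𝒜 : Set (Set D)) : Type u := D ⊕ 𝒜

namespace Mrowka

variable {D : Type u} {𝒜 : Set (Set D)}

/-- The isolated points of the Mrówka space. -/
def pt (d : D) : Mrowka 𝒜 := Sum.inl d

/-- The limit points of the Mrówka space. -/
def lim (A : 𝒜) : Mrowka 𝒜 := Sum.inr A

theorem pt_injective : Function.Injective (pt : D → Mrowka 𝒜) := Sum.inl_injective

theorem pt_ne_lim (d : D) (A : 𝒜) : pt d ≠ lim A := Sum.inl_ne_inr

instance : TopologicalSpace (Mrowka 𝒜) where
  IsOpen U := ∀ A : 𝒜, lim A ∈ U → {d ∈ A.1 | pt d ∉ U}.Finite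
  isOpen_univ A _ := by simp
  isOpen_inter U V hU hV A hA := ((hU A hA.1).union (hV A hA.2)).subset fun d hd => by
    by_cases h : pt d ∈ U
    · exact Or.inr ⟨hd.1, fun h' => hd.2 ⟨h, h'⟩⟩
    · exact Or.inl ⟨hd.1, h⟩
  isOpen_sUnion S hS A := by
    rintro ⟨U, hU, hA⟩
    exact (hS U hU A hA).subset fun d hd => ⟨hd.1, fun h => hd.2 ⟨U, hU, h⟩⟩

theorem isOpen_pt (d : D) : IsOpen ({pt d} : Set (Mrowka 𝒜)) := fun A hA =>
  absurd hA.symm (pt_ne_lim d A)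

/-- The basic neighbourhood of a limit point. -/
def star (A : 𝒜) : Set (Mrowka 𝒜) := insert (lim A) (pt '' A.1)

theorem isOpen_star_diff (A : 𝒜) {F : Set D} (hF : F.Finite) :
    IsOpen (star A \ pt '' F) := by
  intro B hB
  have hBA : B = A := by
    rcases hB.1 with h | ⟨d, -, h⟩
    · exact Sum.inr_injective h
    · exact absurd h (pt_ne_lim d B)
  subst hBA
  refine hF.subset fun d hd => ?_
  by_contra hdF
  refine hd.2 ⟨Or.inr ⟨d, hd.1, rfl⟩, ?_⟩
  rintro ⟨d', hd', h⟩
  exact hdF (pt_injective h ▸ hd')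

theorem isOpen_star (A : 𝒜) : IsOpen (star A) := by
  simpa using isOpen_star_diff A finite_empty

theorem lim_mem_star_diff (A : 𝒜) (F : Set D) : lim A ∈ star A \ pt '' F :=
  ⟨Or.inl rfl, fun ⟨d, _, h⟩ => pt_ne_lim d A h⟩

theorem isCompact_star (A : 𝒜) : IsCompact (star A) := by
  refine isCompact_of_finite_subcover fun {ι} U hU hcov => ?_
  obtain ⟨i, hi⟩ := mem_iUnion.1 (hcov (show lim A ∈ star A from Or.inl rfl))
  have hfin : (pt '' {d ∈ A.1 | pt d ∉ U i} : Set (Mrowka 𝒜)).Finite := (hU i A hi).image _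
  obtain ⟨t, ht⟩ := hfin.isCompact.elim_finite_subcover U hU
    (Subset.trans (b := star A) (by rintro _ ⟨d, hd, rfl⟩; exact Or.inr ⟨d, hd.1, rfl⟩) hcov)
  classical
  refine ⟨insert i t, ?_⟩
  rw [Finset.set_biUnion_insert]
  rintro x (rfl | ⟨d, hd, rfl⟩)
  · exact Or.inl hi
  · by_cases h : pt d ∈ U i
    · exact Or.inl h
    · exact Or.inr (ht ⟨d, ⟨hd, h⟩, rfl⟩)

instance : WeaklyLocallyCompactSpace (Mrowka 𝒜) where
  exists_compact_mem_nhds x := by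
    rcases x with d | A
    · exact ⟨{pt d}, isCompact_singleton, (isOpen_pt d).mem_nhds rfl⟩
    · exact ⟨star A, isCompact_star A, (isOpen_star A).mem_nhds (Or.inl rfl)⟩

theorem t2Space (h : ∀ A ∈ 𝒜, ∀ B ∈ 𝒜, A ≠ B → (A ∩ B).Finite) : T2Space (Mrowka 𝒜) := by
  have pt_lim : ∀ (d : D) (A : 𝒜), ∃ U V : Set (Mrowka 𝒜),
      IsOpen U ∧ IsOpen V ∧ pt d ∈ U ∧ lim A ∈ V ∧ Disjoint U V := fun d A =>
    ⟨{pt d}, star A \ pt '' {d}, isOpen_pt d, isOpen_star_diff A (finite_singleton d), rfl,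
      lim_mem_star_diff A _, by
        rw [disjoint_singleton_left]
        exact fun h => h.2 ⟨d, rfl, rfl⟩⟩
  refine ⟨fun x y hxy => ?_⟩
  rcases x with d | A <;> rcases y with d' | B
  · exact ⟨{pt d}, {pt d'}, isOpen_pt d, isOpen_pt d', rfl, rfl, disjoint_singleton.2 hxy⟩
  · exact pt_lim d B
  · obtain ⟨U, V, hU, hV, hdU, hAV, hUV⟩ := pt_lim d' A
    exact ⟨V, U, hV, hU, hAV, hdU, hUV.symm⟩
  · have hAB : A ≠ B := fun h => hxy (by rw [h])
    refine ⟨star A \ pt '' (A.1 ∩ B.1), star B \ pt '' (A.1 ∩ B.1),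
      isOpen_star_diff A (h _ A.2 _ B.2 fun h => hAB (Subtype.ext h)),
      isOpen_star_diff B (h _ A.2 _ B.2 fun h => hAB (Subtype.ext h)),
      lim_mem_star_diff A _, lim_mem_star_diff B _, ?_⟩
    rw [Set.disjoint_left]
    rintro x ⟨hxA | ⟨d, hd, rfl⟩, hx⟩ ⟨hxB | ⟨d', hd', hdd⟩, -⟩
    · exact hAB (Sum.inr_injective (hxA.symm.trans hxB))
    · exact pt_ne_lim d' A (hdd.trans hxA)
    · exact pt_ne_lim d B hxB
    · obtain rfl := pt_injective hdd
      exact hx ⟨d', ⟨hd, hd'⟩, rfl⟩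

/-- An ideal `p` of subsets of `D` that contains the finite sets and the members of `𝒜` contains the
trace on `D` of every compact subset of the Mrówka space. -/
theorem trace_mem_of_isCompact {p : Set D → Prop} (hmono : ∀ A B, A ⊆ B → p B → p A)
    (hunion : ∀ A B, p A → p B → p (A ∪ B)) (hfin : ∀ A, A.Finite → p A) (h𝒜 : ∀ A ∈ 𝒜, p A)
    {C : Set (Mrowka 𝒜)} (hC : IsCompact C) : p (pt ⁻¹' C) := by
  refine hC.induction_on (p := fun C => p (pt ⁻¹' C)) (hfin _ (by simp))
    (fun s t hst ht => hmono _ _ (preimage_mono hst) ht) (fun s t => hunion _ _) fun x _ => ?_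
  rcases x with d | A
  · refine ⟨{pt d}, mem_nhdsWithin_of_mem_nhds ((isOpen_pt d).mem_nhds rfl), hfin _ ?_⟩
    exact (finite_singleton (pt d)).preimage pt_injective.injOn
  · refine ⟨star A, mem_nhdsWithin_of_mem_nhds ((isOpen_star A).mem_nhds (Or.inl rfl)), ?_⟩
    refine hmono _ _ ?_ (h𝒜 _ A.2)
    rintro d (h | ⟨d', hd', h⟩)
    · exact absurd h (pt_ne_lim d A)
    · exact pt_injective h ▸ hd'

theorem lim_mem_closure {A : 𝒜} {S : Set D} (h : (A.1 ∩ S).Infinite) :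
    lim A ∈ closure (pt '' S : Set (Mrowka 𝒜)) := by
  rw [mem_closure_iff]
  intro U hU hA
  by_contra hne
  refine h ((hU A hA).subset fun d hd => ⟨hd.1, fun hdU => hne ⟨pt d, hdU, d, hd.2, rfl⟩⟩)

end Mrowka

/-! ### Sets of class `F_a` containing many isolated points contain a limit point -/

/-- The compact space in which the class is computed: the one-point compactification of the
Mrówka space of the threads with thin tree. -/
abbrev ThreadSpace (a : Ordinal.{0}) : Type := OnePoint (Mrowka (threadFamily a))

/-- A node as an isolated point of the compact space. -/
def nodePt (a : Ordinal.{0}) (x : Node) : ThreadSpace a := ((Mrowka.pt x : Mrowka (threadFamily a)))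

/-- The limit point of a thread in the compact space. -/
def threadPt {a : Ordinal.{0}} (A : threadFamily a) : ThreadSpace a := (Mrowka.lim A : Mrowka _)

/-- Countably many ample sets, below conditions with a common record, such that every thread
meeting all of them infinitely often converges to a point of `F`. -/
structure IsScheme {α : Ordinal.{0}} (F : Set (ThreadSpace α)) (G : Record) (s : List ℕ)
    (t : ℕ → List ℕ) (S : ℕ → Set Node) : Prop where
  ext : ∀ i, s <+: t i
  ample : ∀ i, Ample (S i) G (t i)
  mem : ∀ A : threadFamily α, (∀ i, (A.1 ∩ S i).Infinite) → threadPt A ∈ F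

/-- The bound on a tree above `s` that corresponds to the class `F_a`. For even `a` it amounts to
`Thin T a s`; for odd `a = c + 1` it says that all proper extensions of `s` are thin of index
`c`. -/
def ThinFor (T : Set (List ℕ)) (a : Ordinal.{0}) (s : List ℕ) : Prop :=
  ∃ (c : Ordinal.{0}) (N : ℕ), IsEvenOrdinal c ∧ N ≤ 1 ∧ c + (N : Ordinal.{0}) ≤ a ∧
    ∀ w : List ℕ, N ≤ w.length → Thin T c (s ++ w)

theorem ThinFor.thin {T : Set (List ℕ)} {a b : Ordinal.{0}} {s : List ℕ} (h : ThinFor T a s)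
    (hab : a ≤ b) : Thin T b s := by
  obtain ⟨c, N, hc, hN, hca, hT⟩ := h
  interval_cases N
  · simpa using (hT [] (by simp)).mono_index (by simpa using hca.trans hab)
  · refine .step _ c 1 _ hc ?_ hT
    exact (Order.lt_add_one_iff.2 le_rfl).trans_le (by simpa using hca.trans hab)

/-- A set of class `F_a` in the compact space that contains an ample set of isolated points
contains the limits of all threads following some scheme, whose tree is bounded according to `a`.
Countable unions are treated by moving to a stronger condition, which prolongs the stem;
countable intersections by working below infinitely many immediate extensions of the stem at
once. -/
theorem IsFClass.exists_scheme {α a : Ordinal.{0}} {F : Set (ThreadSpace α)} (hF : IsFClass a F) :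
    ∀ (G : Record) (s : List ℕ), Ample (nodePt α ⁻¹' F) G s →
      ∃ G' ≥ G, ∃ t S, IsScheme F G' s t S ∧ ThinFor (prefixTree t) a s := by
  induction hF with
  | closed F hF =>
    intro G s h
    refine ⟨G, le_rfl, fun _ => s, fun _ => nodePt α ⁻¹' F,
      ⟨fun _ => List.prefix_refl s, fun _ => h, fun A hA => ?_⟩, 0, 1, isEvenOrdinal_zero, le_rfl,
      by simp, fun w hw => .out _ _ ?_⟩
    · have h1 := Mrowka.lim_mem_closure (hA 0)
      have h2 : IsClosed ((fun z : Mrowka (threadFamily α) => (z : ThreadSpace α)) ⁻¹' F) :=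
        hF.preimage OnePoint.continuous_coe
      exact closure_minimal (image_subset_iff.2 fun x hx => hx) h2 h1
    · rintro ⟨_, hi⟩
      have : (s ++ w).length ≤ s.length := hi.length_le
      rw [List.length_append] at this
      omega
  | union a ha he b hb F _ ih =>
    intro G s h
    rw [preimage_iUnion] at h
    obtain ⟨n, G₁, hG₁, r, hsr, hr⟩ := h.exists_of_iUnion
    obtain ⟨G', hG', t, S, hS, c, N, hc, hN, hcb, hT⟩ := ih n G₁ r hr
    refine ⟨G', hG₁.trans hG', t, S, ⟨fun i => hsr.trans (hS.ext i), hS.ample,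
      fun A hA => mem_iUnion.2 ⟨n, hS.mem A hA⟩⟩, a, 0, he, zero_le_one, by simp, fun w _ => ?_⟩
    refine Thin.append (isTree_prefixTree t) ?_ w
    refine .step a c (r.length + 1) s hc ((le_self_add.trans hcb).trans_lt (hb n)) fun w hw => ?_
    by_cases hrw : r <+: s ++ w
    · obtain ⟨w', hw'⟩ := hrw
      rw [← hw']
      refine hT w' ?_
      have := congrArg List.length hw'
      simp at this
      omega
    · refine .out _ _ ?_
      rintro ⟨i, hi⟩
      exact hrw (List.prefix_of_prefix_length_le (hS.ext i) hi (by simp; omega))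
  | inter a ha ho b hb F _ ih =>
    intro G s h
    obtain ⟨c, hc, rfl⟩ := ho.exists_eq_add_one
    have hle : ∀ m, nodePt α ⁻¹' (⋂ n, F n) ⊆ nodePt α ⁻¹' F m := fun m =>
      preimage_mono (iInter_subset F m)
    obtain ⟨G', hG', hR⟩ := Record.exists_ge_forall
      (fun m G' => ∃ t S, IsScheme (F m) G' (s ++ [m]) t S ∧
        ThinFor (prefixTree t) (b m) (s ++ [m]))
      (fun m G₁ G₂ h12 ⟨t, S, hS, hT⟩ => ⟨t, S,
        ⟨hS.ext, fun i => (hS.ample i).mono Subset.rfl h12 (List.prefix_refl _), hS.mem⟩, hT⟩) G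
      (fun m G₁ hG₁ => ih m G₁ (s ++ [m])
        (h.mono (hle m) hG₁ (List.prefix_append s [m])))
    choose t S hS hT using hR
    refine ⟨G', hG', fun i => t i.unpair.1 i.unpair.2, fun i => S i.unpair.1 i.unpair.2,
      ⟨fun i => (List.prefix_append s _).trans ((hS _).ext _), fun i => (hS _).ample _,
        fun A hA => mem_iInter.2 fun m => (hS m).mem A fun j => ?_⟩,
      c, 1, hc, le_rfl, by simp, fun w hw => ?_⟩
    · simpa using hA (Nat.pair m j)
    · obtain ⟨m, w, rfl⟩ := List.exists_cons_of_length_pos hw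
      have h1 := ((hT m).thin (Order.lt_add_one_iff.1 (hb m))).append (isTree_prefixTree _) w
      rw [List.append_assoc, List.singleton_append] at h1
      refine h1.of_eq_above fun w' hw' => ?_
      obtain ⟨i, hi⟩ := hw'
      -- Above `s ++ [m]` the combined tree only contains the part coming from `F m`.
      have hm : i.unpair.1 = m := by
        have e1 : s ++ [m] <+: t i.unpair.1 i.unpair.2 :=
          List.IsPrefix.trans ⟨w ++ w', by simp⟩ hi
        have e2 := List.prefix_of_prefix_length_le ((hS i.unpair.1).ext i.unpair.2) e1 (by simp)
        have e3 := e2.eq_of_length (by simp)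
        simpa using e3
      subst hm
      exact ⟨_, hi⟩

/-- A set of class `F_α` containing all isolated points contains a limit point. -/
theorem IsFClass.exists_threadPt_mem {α : Ordinal.{0}} {F : Set (ThreadSpace α)}
    (hF : IsFClass α F) (h : range (nodePt α) ⊆ F) : ∃ A : threadFamily α, threadPt A ∈ F := by
  obtain ⟨G⟩ := (inferInstance : Nonempty Record)
  have hu : nodePt α ⁻¹' F = univ := eq_univ_of_forall fun x => h (mem_range_self x)
  obtain ⟨G', -, t, S, hS, hT⟩ := hF.exists_scheme G [] (hu ▸ ample_univ G [])
  obtain ⟨u, huT, huS, hsplit⟩ := exists_thread hS.ample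
  exact ⟨⟨range u, ⟨u, huT, rfl⟩, (hT.thin le_rfl).anti hsplit⟩, hS.mem _ huS⟩

/-! ### Spaces with one nonisolated point -/

/-- `X` consists of isolated points `pt x`, `x` a node, and a point `base`, and the complements of
the neighbourhoods of `base` have thin trees of index `α`. -/
structure IsNodeSpace (α : Ordinal.{0}) {X : Type u} [TopologicalSpace X] (base : X)
    (pt : Node → X) : Prop where
  cover : ∀ z, z = base ∨ ∃ x, z = pt x
  pt_injective : Function.Injective pt
  isOpen_pt : ∀ x, IsOpen {pt x}
  thin : ∀ V, IsOpen V → base ∈ V → Thin (splitTree {x | pt x ∉ V}) α []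

namespace IsNodeSpace

variable {α : Ordinal.{0}} {X : Type u} {base : X} {pt : Node → X}
  {Y : Type v} [TopologicalSpace Y] {e : X → Y}

/-- The closure, in an extension of the space, of the set of nodes with label in the cylinder of
`s`, together with the nonisolated point. -/
def cell (base : X) (pt : Node → X) (e : X → Y) (s : List ℕ) : Set Y :=
  insert (e base) (closure (e '' (pt '' (Node.label ⁻¹' cyl s))))

theorem isClosed_cell [T1Space Y] (s : List ℕ) : IsClosed (cell base pt e s) := by
  rw [cell, insert_eq]
  exact isClosed_singleton.union isClosed_closure

variable [TopologicalSpace X]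

/-- Every point of the space lies in the cells along some infinite branch. -/
theorem exists_branch (h : IsNodeSpace α base pt) (z : X) :
    ∃ y : ℕ → ℕ, ∀ s, y ∈ cyl s → e z ∈ cell base pt e s := by
  rcases h.cover z with rfl | ⟨x, rfl⟩
  · exact ⟨0, fun s _ => Or.inl rfl⟩
  · exact ⟨x.label, fun s hs => Or.inr (subset_closure ⟨_, ⟨x, hs, rfl⟩, rfl⟩)⟩

/-- A point outside the space is separated from `base`; up to a set `B` of nodes with thin tree,
it is therefore outside the closure of the nodes. -/
theorem exists_thin_set [T2Space Y] (h : IsNodeSpace α base pt) (he : IsEmbedding e) {y : Y}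
    (hy : y ∉ range e) : ∃ B : Set Node, Thin (splitTree B) α [] ∧
      (∀ P ⊆ B, IsClosed (pt '' P)) ∧ ∀ s, y ∈ cell base pt e s →
        s ∈ splitTree B ∧ y ∈ closure (e '' (pt '' (B ∩ Node.label ⁻¹' cyl s))) := by
  have hne : y ≠ e base := fun h => hy ⟨base, h.symm⟩
  obtain ⟨W, V, hW, hV, hyW, hbV, hWV⟩ := t2_separation hne
  have hVo : IsOpen (e ⁻¹' V) := hV.preimage he.continuous
  refine ⟨{x | pt x ∉ e ⁻¹' V}, h.thin _ hVo hbV, fun P hP => ?_, fun s hs => ?_⟩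
  · rw [← isOpen_compl_iff]
    have : (pt '' P)ᶜ = e ⁻¹' V ∪ ⋃ z ∈ {z | (∃ x, z = pt x) ∧ z ∉ pt '' P}, {z} := by
      ext z
      simp only [mem_compl_iff, mem_union, mem_iUnion, mem_singleton_iff, exists_prop,
        exists_eq_right']
      constructor
      · intro hz
        rcases h.cover z with rfl | hx
        · exact Or.inl hbV
        · exact Or.inr ⟨hx, hz⟩
      · rintro (hz | hz)
        · rintro ⟨x, hx, rfl⟩
          exact hP hx hz
        · exact hz.2
    rw [this]
    refine hVo.union (isOpen_biUnion ?_)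
    rintro _ ⟨⟨x, rfl⟩, -⟩
    exact h.isOpen_pt x
  · have hcl : y ∈ closure (e '' (pt '' ({x | pt x ∉ e ⁻¹' V} ∩ Node.label ⁻¹' cyl s))) := by
      rw [mem_closure_iff]
      intro U hU hyU
      obtain ⟨_, ⟨hzU, hzW⟩, _, ⟨x, hx, rfl⟩, rfl⟩ :=
        mem_closure_iff.1 (hs.resolve_left hne) (U ∩ W) (hU.inter hW) ⟨hyU, hyW⟩
      exact ⟨_, hzU, _, ⟨x, ⟨fun hxV => Set.disjoint_left.1 hWV hzW hxV, hx⟩, rfl⟩, rfl⟩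
    refine ⟨fun hfin => hy ?_, hcl⟩
    have hcl' := ((Set.Finite.image pt hfin).image e).isClosed.closure_eq.subset hcl
    exact image_subset_range _ _ hcl'

/-- The space consists of those points of an extension at which the tree of cells is not thin. -/
theorem range_eq [T2Space Y] (h : IsNodeSpace α base pt) (he : IsEmbedding e) :
    range e = {y | ¬ Thin {s | y ∈ cell base pt e s} α []} := by
  ext y
  constructor
  · rintro ⟨z, rfl⟩
    obtain ⟨b, hb⟩ := h.exists_branch (e := e) z
    exact not_thin_of_branch hb (by simp [cyl_nil])
  · intro hy
    by_contra hy'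
    obtain ⟨B, hB, -, hBs⟩ := h.exists_thin_set he hy'
    exact hy (hB.anti fun s hs => (hBs s hs).1)

end IsNodeSpace

/-- The set of points at which a tree of closed sets is not thin of even index `a` is of class
`F_{a+1}`. -/
theorem isFClass_setOf_not_thin {Y : Type v} [TopologicalSpace Y] {C : List ℕ → Set Y}
    (hC : ∀ s, IsClosed (C s)) {a : Ordinal.{0}} (ha : IsEvenOrdinal a)
    (hω : a < Ordinal.omega 1) (s : List ℕ) :
    IsFClass (a + 1) {y | ¬ Thin {s | y ∈ C s} a s} := by
  induction a using WellFoundedLT.induction generalizing s with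
  | ind a ih =>
  rcases eq_or_ne a 0 with rfl | h0
  · have : {y | ¬ Thin {s | y ∈ C s} 0 s} = C s := by
      ext y
      constructor
      · intro hy
        by_contra hyC
        exact hy (.out _ _ hyC)
      · rintro hy (⟨_, _, h⟩ | ⟨_, b, _, _, _, hb, _⟩)
        · exact h hy
        · exact absurd hb not_lt_zero
    rw [this, zero_add]
    exact .closed _ (hC s)
  have h2 : 2 ≤ a := ha.two_le h0
  have h3 : 3 ≤ a + 1 := by
    have : (2 : Ordinal.{0}) + 1 ≤ a + 1 := by gcongr
    rwa [two_add_one_eq_three] at this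
  -- Thinness at `s` quantifies over the countably many pairs of a smaller even index and a height.
  have : Countable (Iio a) := by
    rw [← Cardinal.mk_le_aleph0_iff, Cardinal.mk_Iio_ordinal, Cardinal.lift_le_aleph0,
      ← Order.lt_succ_iff, Cardinal.succ_aleph0, ← Cardinal.lt_ord, Cardinal.ord_aleph]
    exact hω
  let ι : Type _ := {b : Iio a // IsEvenOrdinal b.1} × ℕ
  have : Nonempty ι := ⟨⟨⟨0, pos_iff_ne_zero.2 h0⟩, isEvenOrdinal_zero⟩, 0⟩
  obtain ⟨f, hf⟩ := exists_surjective_nat ι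
  let U : ι → Set Y := fun i => ⋃ w : {w : List ℕ // i.2 ≤ w.length},
    {y | ¬ Thin {s | y ∈ C s} i.1.1.1 (s ++ w)}
  have hU : ∀ i, IsFClass a (U i) := by
    rintro ⟨⟨⟨b, hba⟩, hb⟩, N⟩
    have : Nonempty {w : List ℕ // N ≤ w.length} := ⟨List.replicate N 0, by simp⟩
    obtain ⟨g, hg⟩ := exists_surjective_nat {w : List ℕ // N ≤ w.length}
    have hUg : U (⟨⟨b, hba⟩, hb⟩, N) = ⋃ n, {y | ¬ Thin {s | y ∈ C s} b (s ++ (g n : List ℕ))} :=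
      (hg.iUnion_comp fun w : {w : List ℕ // N ≤ w.length} =>
        {y | ¬ Thin {s | y ∈ C s} b (s ++ (w : List ℕ))}).symm
    rw [hUg]
    exact .union a h2 ha (fun _ => b + 1) (fun _ => ha.add_one_lt hb hba) _ fun n =>
      ih b hba hb (lt_trans hba hω) _
  have heq : {y | ¬ Thin {s | y ∈ C s} a s} =
      ⋂ n : ℕ, Nat.casesOn (motive := fun _ => Set Y) n (C s) fun n => U (f n) := by
    ext y
    rw [mem_iInter]
    constructor
    · rintro hy (_ | n)
      · by_contra hyC
        exact hy (.out _ _ hyC)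
      · by_contra hyU
        refine hy (.step _ (f n).1.1.1 (f n).2 _ (f n).1.2 (f n).1.1.2 fun w hw => ?_)
        by_contra hw'
        exact hyU (mem_iUnion.2 ⟨⟨w, hw⟩, hw'⟩)
    · rintro hy (⟨_, _, h⟩ | ⟨_, b, N, _, hb, hba, h⟩)
      · exact h (hy 0)
      · obtain ⟨n, hn⟩ := hf ⟨⟨⟨b, hba⟩, hb⟩, N⟩
        have := hy (n + 1)
        simp only [hn] at this
        obtain ⟨w, hw⟩ := mem_iUnion.1 this
        exact hw (h w w.2)
  rw [heq]
  refine .inter (a + 1) h3 ha.add_one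
    (fun n => Nat.casesOn (motive := fun _ => Ordinal.{0}) n 1 fun _ => a) ?_ _ ?_
  · rintro (_ | n)
    · exact lt_of_lt_of_le (by norm_num) h3
    · exact Order.lt_add_one_iff.2 le_rfl
  · rintro (_ | n)
    · exact .closed _ (hC s)
    · exact hU (f n)

/-- Complementary clopen sets have disjoint closures in the Stone–Čech compactification. -/
theorem IsClopen.disjoint_closure_stoneCechUnit {X : Type u} [TopologicalSpace X] {P : Set X}
    (hP : IsClopen P) :
    Disjoint (closure (stoneCechUnit '' P)) (closure (stoneCechUnit '' Pᶜ)) := by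
  have hf : Continuous P.boolIndicator := (continuous_boolIndicator_iff_isClopen P).2 hP
  have hcl : ∀ b : Bool, IsClosed (stoneCechExtend hf ⁻¹' {b}) := fun b =>
    (isClosed_discrete {b}).preimage (continuous_stoneCechExtend hf)
  have h1 : closure (stoneCechUnit '' P) ⊆ stoneCechExtend hf ⁻¹' {true} := by
    refine closure_minimal ?_ (hcl true)
    rintro _ ⟨z, hz, rfl⟩
    rw [mem_preimage, stoneCechExtend_stoneCechUnit]
    exact (mem_iff_boolIndicator P z).1 hz
  have h2 : closure (stoneCechUnit '' Pᶜ) ⊆ stoneCechExtend hf ⁻¹' {false} := by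
    refine closure_minimal ?_ (hcl false)
    rintro _ ⟨z, hz, rfl⟩
    rw [mem_preimage, stoneCechExtend_stoneCechUnit]
    exact (notMem_iff_boolIndicator P z).1 hz
  exact (Disjoint.preimage _ (by simp)).mono h1 h2

namespace IsNodeSpace

variable {α : Ordinal.{0}} {X : Type u} [TopologicalSpace X] {base : X} {pt : Node → X}

theorem isAbsoluteFSpace (h : IsNodeSpace α base pt) (hα : IsEvenOrdinal α)
    (hω : α < Ordinal.omega 1) : IsAbsoluteFSpace.{u, v} (α + 1) X := by
  intro Y _ _ e he _
  rw [h.range_eq he]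
  exact isFClass_setOf_not_thin (fun s => isClosed_cell s) hα hω []

/-- In the Stone–Čech compactification, disjoint clopen sets have disjoint closures, so the cells
containing a given point outside the space form a single branch; hence there is no such point in a
cell on each level. -/
theorem isFSigmaDeltaSpace [T35Space X] (h : IsNodeSpace α base pt) : IsFSigmaDeltaSpace X := by
  refine ⟨StoneCech X, inferInstance, inferInstance, inferInstance, stoneCechUnit,
    isEmbedding_stoneCechUnit, denseRange_stoneCechUnit, ?_⟩
  have hlist : ∀ n, ∃ g : ℕ → List ℕ, range g = {s | s.length = n} := fun n => by
    obtain ⟨g, hg⟩ := (to_countable {s : List ℕ | s.length = n}).exists_eq_range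
      ⟨List.replicate n 0, by simp⟩
    exact ⟨g, hg.symm⟩
  choose g hg using hlist
  refine ⟨fun n m => cell base pt stoneCechUnit (g n m), fun n m => isClosed_cell _, ?_⟩
  apply Subset.antisymm
  · rintro _ ⟨z, rfl⟩
    obtain ⟨b, hb⟩ := h.exists_branch (e := stoneCechUnit) z
    refine mem_iInter.2 fun n => ?_
    obtain ⟨m, hm⟩ : (List.ofFn fun i : Fin n => b i) ∈ range (g n) := by simp [hg]
    refine mem_iUnion.2 ⟨m, ?_⟩
    beta_reduce
    rw [hm]
    exact hb _ (mem_cyl_ofFn b n)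
  · intro y hy
    by_contra hyX
    obtain ⟨B, hB, hBcl, hBs⟩ := h.exists_thin_set isEmbedding_stoneCechUnit hyX
    have hs : ∀ n, ∃ s : List ℕ, s.length = n ∧ y ∈ cell base pt stoneCechUnit s := fun n => by
      obtain ⟨m, hm⟩ := mem_iUnion.1 (mem_iInter.1 hy n)
      exact ⟨g n m, (hg n).subset (mem_range_self m), hm⟩
    choose s hsn hsy using hs
    have hcomp : ∀ m n, m ≤ n → s m <+: s n := by
      intro m n hmn
      by_contra hpre
      set P := pt '' (B ∩ Node.label ⁻¹' cyl (s m))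
      have hPo : IsOpen P := by
        rw [← biUnion_of_singleton P]
        refine isOpen_biUnion ?_
        rintro _ ⟨x, -, rfl⟩
        exact h.isOpen_pt x
      have hPc : IsClopen P := ⟨hBcl _ inter_subset_left, hPo⟩
      have hyP : y ∈ closure (stoneCechUnit '' P) := (hBs _ (hsy m)).2
      have hyP' : y ∈ closure (stoneCechUnit '' Pᶜ) := by
        refine closure_mono (image_mono ?_) (hBs _ (hsy n)).2
        rintro _ ⟨x, hx, rfl⟩ ⟨x', hx', hxx'⟩
        exact hpre (prefix_of_mem_cyl (h.pt_injective hxx' ▸ hx'.2) hx.2 (by simp [hsn, hmn]))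
      exact Set.disjoint_left.1 (hPc.disjoint_closure_stoneCechUnit) hyP hyP'
    have hinf : ∀ n, s n ∈ splitTree B := fun n => (hBs _ (hsy n)).1
    refine not_thin_of_branch (y := fun i => (s (i + 1)).getD i 0) (fun r hr => ?_)
      (by simp [cyl_nil]) hB
    have : (fun i => (s (i + 1)).getD i 0) ∈ cyl (s r.length) := by
      intro i hi
      rw [hsn] at hi
      obtain ⟨w, hw⟩ := hcomp (i + 1) r.length hi
      have hi' : i < (s (i + 1)).length := by simp [hsn]
      rw [← hw, List.getElem?_append_left hi']
      simp [hi']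
    exact isTree_splitTree B (prefix_of_mem_cyl hr this (hsn _).ge) (hinf _)

end IsNodeSpace

/-! ### The space of nodes -/

/-- The compact space without the limit points of the threads. -/
abbrev NodeSpace (α : Ordinal.{0}) : Type := {z : ThreadSpace α // z ∉ range (threadPt (a := α))}

instance (α : Ordinal.{0}) : T2Space (Mrowka (threadFamily α)) :=
  Mrowka.t2Space fun _ hA _ hB => threadFamily_almostDisjoint hA hB

theorem nodePt_notMem (α : Ordinal.{0}) (x : Node) : nodePt α x ∉ range (threadPt (a := α)) := by
  rintro ⟨A, hA⟩
  exact Mrowka.pt_ne_lim x A (OnePoint.coe_injective hA).symm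

theorem isNodeSpace (α : Ordinal.{0}) : IsNodeSpace α
    (⟨OnePoint.infty, by rintro ⟨A, hA⟩; exact OnePoint.coe_ne_infty _ hA⟩ : NodeSpace α)
    (fun x => ⟨nodePt α x, nodePt_notMem α x⟩) where
  cover := by
    rintro ⟨z, hz⟩
    induction z using OnePoint.rec with
    | infty => exact Or.inl rfl
    | coe z =>
      rcases z with x | A
      · exact Or.inr ⟨x, rfl⟩
      · exact absurd ⟨A, rfl⟩ hz
  pt_injective x x' h :=
    Mrowka.pt_injective (OnePoint.coe_injective (congrArg Subtype.val h))
  isOpen_pt x := by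
    have : IsOpen {nodePt α x} := by
      have := OnePoint.isOpen_image_coe.2 (Mrowka.isOpen_pt (𝒜 := threadFamily α) x)
      rwa [image_singleton] at this
    convert this.preimage continuous_subtype_val using 1
    ext z
    exact Subtype.ext_iff
  thin V hV hb := by
    obtain ⟨U, hU, rfl⟩ := isOpen_induced_iff.1 hV
    have hC := ((OnePoint.isOpen_iff_of_mem hb).1 hU).2
    refine Mrowka.trace_mem_of_isCompact (p := fun B => Thin (splitTree B) α [])
      (fun A B hAB hB => hB.anti (splitTree_mono hAB)) (fun A B hA hB => ?_)
      (fun A hA => .out _ _ (by simp [splitTree_of_finite hA])) (fun A hA => hA.2) hC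
    rw [splitTree_union]
    exact hA.union (isTree_splitTree A) (isTree_splitTree B) hB

theorem denseRange_val (α : Ordinal.{0}) :
    DenseRange (Subtype.val : NodeSpace α → ThreadSpace α) := by
  intro z
  by_cases hz : z ∈ range (threadPt (a := α))
  · obtain ⟨A, rfl⟩ := hz
    obtain ⟨⟨u, hu, hA⟩, -⟩ := A.2
    have hinf : (A.1 ∩ univ).Infinite := by
      rw [inter_univ, hA]
      exact infinite_range_of_injective hu.injective
    have := image_closure_subset_closure_image OnePoint.continuous_coe
      (mem_image_of_mem _ (Mrowka.lim_mem_closure hinf))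
    refine closure_mono ?_ this
    rintro _ ⟨_, ⟨x, -, rfl⟩, rfl⟩
    exact ⟨⟨nodePt α x, nodePt_notMem α x⟩, rfl⟩
  · exact subset_closure ⟨⟨z, hz⟩, rfl⟩

theorem mainTheorem1 (α : Ordinal.{0}) (hα : IsEvenOrdinal α) (h4 : 4 ≤ α)
    (hω : α < Ordinal.omega 1) :
    ∃ (T : Type) (_ : TopologicalSpace T), T35Space T ∧
      IsFSigmaDeltaSpace T ∧
      ¬ IsAbsoluteFSpace.{0, 0} α T ∧
      IsAbsoluteFSpace.{0, v} (α + 1) T := by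
  refine ⟨NodeSpace α, inferInstance, inferInstance, (isNodeSpace α).isFSigmaDeltaSpace, ?_,
    (isNodeSpace α).isAbsoluteFSpace hα hω⟩
  intro h
  have hF := h (ThreadSpace α) Subtype.val IsEmbedding.subtypeVal (denseRange_val α)
  have hr : range (Subtype.val : NodeSpace α → ThreadSpace α) = (range threadPt)ᶜ :=
    Subtype.range_coe
  rw [hr] at hF
  obtain ⟨A, hA⟩ := hF.exists_threadPt_mem (by rintro _ ⟨x, rfl⟩; exact nodePt_notMem α x)
  exact hA (mem_range_self A)
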